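/- Let $R$ be an integral domain and let $n=2^m$. For a square matrix $M$ of even size with quadrants $M_{11},M_{12},M_{21},M_{22}$ put $\Delta(M)=\det(M_{11})\,M_{22}-M_{21}\,\mathrm{Adj}(M_{11})\,M_{12}$. For an $n\times n$ matrix $A$ and $0\le i\le \log_2 n-2$ put $$k_i=\frac{(2^i-1)n}{2^i},\qquad f_i(A)=\det\bigl(A_{1..k_i,\,1..k_i}\bigr)^{n/2^{i+1}},\qquad N_i=\frac{(2^{i+1}-1)n}{2^{i+1}}+1,$$ where $A_{1..k,1..k}$ is the upper left $k\times k$ submatrix and its determinant is $1$ for $k=0$. A pure $\Delta$-chain of $A$ with factors $c_i$ is a sequence $C_0=A,\ C_1,\ C_2,\dots$ with $\Delta_i:=\Delta(C_i)=c_i\,C_{i+1}$ for $0\le i\le\log_2 n-2$; so $\Delta_i$ is the $\Delta$ of the previous, already cancelled matrix, and $C_{i+1}$ is $\Delta_i$ divided elementwise by $c_i$. A content of a matrix is a greatest common divisor of all its entries (it is unique up to units). 1. (Systematic content.) Let $A=(a_{rs})$ be the symbolic $n\times n$ matrix, whose entries are distinct indeterminates over $R$. There is a pure $\Delta$-chain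 of $A$ over $R[a_{rs}]$ in which every $c_i$ is a content of $\Delta_i$. In every such chain, for all $0\le i\le\log_2 n-2$, $f_i(A)$ is a content of $\Delta_i$, and every entry of the cancelled matrix $C_{i+1}$ is nonzero and has degree exactly $N_i d$ when each symbol $a_{rs}$ is given degree $d$ (for every $d\ge 0$). 2. (Upper bound for all polynomial matrices.) Let $B$ be an $n\times n$ matrix over a polynomial ring $R[x_\sigma]$ all of whose entries have total degree at most $d$. Then the divisions by the systematic content are exact: $B$ has a pure $\Delta$-chain with factors $c_i=f_i(B)$. In every such chain, for every $0\le i\le\log_2 n-2$ such that $f_0(B),\dots,f_i(B)\neq 0$, every entry of the cancelled $\Delta_i$ has total degree at most $N_i d$. 3. (Exact degree for generic polynomial matrices.) Let $\sigma$ be a nonempty set of variables and $d\ge0$. There is a nonzero polynomial $\Phi$ over $R$ in indeterminates $u_{r,s,\alpha}$ ($1\le r,s\le n$, $\alpha$ a monomial in the variables $x_\sigma$ of degree at most $d$) such that for every integral domain $S$ that is an $R$-algebra and every $n\times n$ matrix $B$ over $S[x_\sigma]$ with entries of total degree at most $d$ whose coefficients do not annihilate $\Phi$, all $f_i(B)$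 with $0\le i\le\log_2 n-2$ are nonzero and, in every pure $\Delta$-chain of $B$ with factors $f_i(B)$, every entry of the cancelled $\Delta_i$ is nonzero and has total degree exactly $N_i d$, for all $0\le i\le \log_2 n-2$. 4. $N_i d\le nd$ for all $0\le i\le\log_2 n-2$ and all $d\ge 0$; so the cancelled degree is $O(nd)$. -/

import Mathlib

/-- The size of the matrices after `i` halvings of a matrix of size `n`. -/
def halve (n : ℕ) : ℕ → ℕ
  | 0 => n
  | i + 1 => halve n i / 2

theorem halve_eq (n i : ℕ) : halve n i = n / 2 ^ i := by
  induction i with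
  | zero => simp [halve]
  | succ i ih => rw [halve, ih, Nat.div_div_eq_div_mul, pow_succ]

/-- Index of the first half of the rows (or columns). -/
def loIdx {N : ℕ} (a : Fin (N / 2)) : Fin N := ⟨a, by omega⟩

/-- Index of the second half of the rows (or columns). -/
def hiIdx {N : ℕ} (a : Fin (N / 2)) : Fin N := ⟨N / 2 + a, by omega⟩

/-- The fraction free Schur complement `Δ = Det(M₁₁) M₂₂ - M₂₁ Adj(M₁₁) M₁₂` of a matrix `M` of
even size, where the `Mᵢⱼ` are the four quadrants of `M`. -/
def deltaMat {N : ℕ} {S : Type*} [CommRing S] (M : Matrix (Fin N) (Fin N) S) :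
    Matrix (Fin (N / 2)) (Fin (N / 2)) S :=
  (M.submatrix loIdx loIdx).det • M.submatrix hiIdx hiIdx
    - M.submatrix hiIdx loIdx * (M.submatrix loIdx loIdx).adjugate * M.submatrix loIdx hiIdx

/-- `Det(A_{1..k,1..k})`, the leading principal minor of order `k`; it is `1` for `k = 0`. -/
def leadingDet {n : ℕ} {S : Type*} [CommRing S] (A : Matrix (Fin n) (Fin n) S) (k : ℕ) : S :=
  (A.submatrix (Subtype.val : {j : Fin n // (j : ℕ) < k} → Fin n)
    (Subtype.val : {j : Fin n // (j : ℕ) < k} → Fin n)).det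

/-- `c` is a content of the matrix `M`: a greatest common divisor of all its entries. -/
def IsMatrixContent {N : ℕ} {S : Type*} [CommRing S] (c : S) (M : Matrix (Fin N) (Fin N) S) :
    Prop :=
  (∀ r s, c ∣ M r s) ∧ ∀ g : S, (∀ r s, g ∣ M r s) → g ∣ c

/-- The pure `Δ` chain of `A`, with the factors `c i` cancelled: `C 0 = A`, the matrix `Δ_i` is
`deltaMat (C i)`, and `C (i + 1)` is `Δ_i` divided elementwise by `c i`, as long as `Δ_i` has size
at least `2`. -/
structure IsDeltaChain {n : ℕ} {S : Type*} [CommRing S] (A : Matrix (Fin n) (Fin n) S)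
    (c : ℕ → S) (C : (i : ℕ) → Matrix (Fin (halve n i)) (Fin (halve n i)) S) : Prop where
  zero : C 0 = A
  step : ∀ i, 2 ≤ halve n (i + 1) → deltaMat (C i) = c i • C (i + 1)

/-- The pure `Δ` chain of `A` in which each `Δ_i` of size at least `2` is divided by its content. -/
def IsPrimitiveDeltaChain {n : ℕ} {S : Type*} [CommRing S] (A : Matrix (Fin n) (Fin n) S)
    (c : ℕ → S) (C : (i : ℕ) → Matrix (Fin (halve n i)) (Fin (halve n i)) S) : Prop :=
  IsDeltaChain A c C ∧ ∀ i, 2 ≤ halve n (i + 1) → IsMatrixContent (c i) (deltaMat (C i))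

/-- The factor `Det(A_{1..k,1..k}) ^ (n / 2 ^ (i + 1))` with `k = (2 ^ i - 1) n / 2 ^ i`. -/
def deltaFactor {n : ℕ} {S : Type*} [CommRing S] (A : Matrix (Fin n) (Fin n) S) (i : ℕ) : S :=
  leadingDet A ((2 ^ i - 1) * n / 2 ^ i) ^ (n / 2 ^ (i + 1))

/-!
The chain has a closed form. Write `k i = n - n / 2 ^ i`. The `i`-th cancelled matrix of `A`
consists of the minors of order `k i + 1` of `A` that border the leading principal block of order
`k i` by one further row and one further column (`minorChain`). Indeed an entry of `Δ(M)` is a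
minor of `M` that borders the first quadrant of `M` (`deltaMat_apply`), and Sylvester's
determinant identity (`Matrix.det_borderedMinors`) evaluates the minors of a matrix of bordered
minors: the result is a bordered minor of `A` for the larger block, multiplied by a power of the
leading minor of order `k i` (`deltaMat_leadingMinors`), and this power is the factor `f_i(A)`.
Sylvester's identity holds over every commutative ring, by specialization from a domain of
integral polynomials, so the divisions by `f_i` are always exact. Over a domain they determine the
chain as long as no factor vanishes (`IsDeltaChain.eq_minorChain`), and the upper bound for the
degrees is the one for determinants of order `k i + 1`.

For the symbolic matrix it remains to see that the matrix of bordered minors has content `1`. Over a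
general domain `R` the polynomial ring has no unique factorization, so the argument rests on primes:
the determinant of a matrix of distinct indeterminates is prime (`Matrix.prime_det_X`). It is of the
form `a x + b`, where `x` is the last indeterminate and `a` is a generic determinant of smaller
order. By induction `a` is prime, it does not divide `b`, and a linear polynomial with these
properties is prime by pseudo-division (`Polynomial.prime_C_mul_X_add_C`). So two diagonal bordered
minors `p`, `q` are primes, and `p` does not divide `q`. If `g w = c p` and `g v = c q`, then
`w q = p v`, so `p` divides `w` and hence `g` divides `c`
(`isMatrixContent_smul_leadingMinors`). As contents are unique up to units, every primitive chain of
the symbolic matrix agrees with `minorChain` up to units, and bordered minors of the symbolic matrix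
are homogeneous.

For the generic exactness, the coefficient of `x ^ (k d)` in a minor of order `k` of `B` is the
same minor of the matrix of the coefficients of `x ^ d` (`MvPolynomial.coeff_single_det`). So `Φ`
may be taken as the product of all minors of the symbolic matrix that occur in the chain
(`chainDiscriminant`), in the indeterminates that belong to `x ^ d`.
-/

/-! ### Bordered minors -/

section Bordered

open Matrix

variable {α β S : Type*} [Fintype α] [DecidableEq α] [CommRing S]

/-- The fraction free form of the Schur complement formula for the determinant. It results from
block elimination with the adjugate of the upper left block in place of its inverse. -/
theorem Matrix.det_fromBlocks_mul_det_pow [Fintype β] [DecidableEq β] [IsDomain S]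
    (P : Matrix α α S) (Q : Matrix α β S)
    (U : Matrix β α S) (T : Matrix β β S) (hP : P.det ≠ 0) :
    (fromBlocks P Q U T).det * P.det ^ Fintype.card β =
      P.det * (P.det • T - U * P.adjugate * Q).det := by
  have h : fromBlocks P Q U T * fromBlocks P.adjugate (-(P.adjugate * Q)) 0 (P.det • 1) =
      fromBlocks (P.det • 1) 0 (U * P.adjugate) (P.det • T - U * P.adjugate * Q) := by
    rw [fromBlocks_multiply]
    congr 1
    · simp [mul_adjugate]
    · simp [← Matrix.mul_assoc, mul_adjugate]
    · simp
    · simp [← Matrix.mul_assoc, sub_eq_neg_add]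
  have hd := congrArg det h
  rw [det_mul, det_fromBlocks_zero₂₁, det_fromBlocks_zero₁₂, det_smul, det_smul, det_one, det_one,
    mul_one, mul_one] at hd
  have ha : P.det * P.adjugate.det = P.det ^ Fintype.card α := by
    rw [← det_mul, mul_adjugate, det_smul, det_one, mul_one]
  refine mul_left_cancel₀ (pow_ne_zero (Fintype.card α) hP) ?_
  linear_combination P.det * hd - (fromBlocks P Q U T).det * P.det ^ Fintype.card β * ha

theorem Matrix.det_toBlocks₁₁_mvPolynomialX_ne_zero [DecidableEq β] :
    (mvPolynomialX (α ⊕ β) (α ⊕ β) ℤ).toBlocks₁₁.det ≠ 0 := by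
  intro h
  have h1 := congrArg (MvPolynomial.eval fun p : (α ⊕ β) × (α ⊕ β) => (1 : Matrix _ _ ℤ) p.1 p.2) h
  rw [RingHom.map_det, map_zero] at h1
  refine one_ne_zero (α := ℤ) (Eq.trans ?_ h1)
  rw [← det_one (n := α)]
  congr 1
  ext i j
  simp [toBlocks₁₁, one_apply]

theorem Matrix.map_mul_adjugate_mul_apply {T γ δ : Type*} [CommRing T] (f : S →+* T)
    (U : Matrix γ α S) (P : Matrix α α S) (Q : Matrix α δ S) (r : γ) (s : δ) :
    f ((U * P.adjugate * Q) r s) = (U.map f * (f.mapMatrix P).adjugate * Q.map f) r s := by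
  rw [← RingHom.map_adjugate, RingHom.mapMatrix_apply, ← Matrix.map_mul, ← Matrix.map_mul]
  rfl

/-- The expansion of a determinant along its last row and last column. -/
theorem Matrix.det_eq_det_mul_sub_adjugate (M : Matrix (α ⊕ Unit) (α ⊕ Unit) S) :
    M.det = M.toBlocks₁₁.det * M (.inr ()) (.inr ()) -
      (M.toBlocks₂₁ * M.toBlocks₁₁.adjugate * M.toBlocks₁₂) () () := by
  -- over the integral domain of integral polynomials in the entries, `det M₁₁` can be cancelled
  have hgen : ∀ M : Matrix (α ⊕ Unit) (α ⊕ Unit) (MvPolynomial ((α ⊕ Unit) × (α ⊕ Unit)) ℤ),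
      M.toBlocks₁₁.det ≠ 0 → M.det = M.toBlocks₁₁.det * M (.inr ()) (.inr ()) -
        (M.toBlocks₂₁ * M.toBlocks₁₁.adjugate * M.toBlocks₁₂) () () := by
    intro M hM
    have h := det_fromBlocks_mul_det_pow M.toBlocks₁₁ M.toBlocks₁₂ M.toBlocks₂₁ M.toBlocks₂₂ hM
    rw [fromBlocks_toBlocks, Fintype.card_unit, pow_one, mul_comm] at h
    rw [mul_left_cancel₀ hM h, det_unique]
    rfl
  let f : MvPolynomial ((α ⊕ Unit) × (α ⊕ Unit)) ℤ →+* S :=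
    (MvPolynomial.aeval fun p : (α ⊕ Unit) × (α ⊕ Unit) => M p.1 p.2).toRingHom
  have hf : f.mapMatrix (mvPolynomialX _ _ ℤ) = M := mvPolynomialX_mapMatrix_aeval ℤ M
  have h := congrArg f (hgen _ det_toBlocks₁₁_mvPolynomialX_ne_zero)
  rw [map_sub, map_mul, RingHom.map_det, RingHom.map_det,
    map_mul_adjugate_mul_apply] at h
  rw [← hf]
  exact h

/-- The matrix of the minors that border the upper left block `M₁₁` by one row and one column. -/
def Matrix.borderedMinors (M : Matrix (α ⊕ β) (α ⊕ β) S) : Matrix β β S :=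
  of fun b b' => (M.submatrix (Sum.map id fun _ : Unit => b) (Sum.map id fun _ : Unit => b')).det

theorem Matrix.borderedMinors_eq (M : Matrix (α ⊕ β) (α ⊕ β) S) :
    M.borderedMinors =
      M.toBlocks₁₁.det • M.toBlocks₂₂ - M.toBlocks₂₁ * M.toBlocks₁₁.adjugate * M.toBlocks₁₂ := by
  ext b b'
  rw [borderedMinors, of_apply, det_eq_det_mul_sub_adjugate]
  rfl

/-- **Sylvester's determinant identity**. -/
theorem Matrix.det_borderedMinors [Fintype β] [DecidableEq β] (M : Matrix (α ⊕ β) (α ⊕ β) S)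
    {h : ℕ} (hβ : Fintype.card β = h + 1) :
    M.borderedMinors.det = M.toBlocks₁₁.det ^ h * M.det := by
  -- over the integral domain of integral polynomials in the entries, `det M₁₁` can be cancelled
  have hgen : ∀ M : Matrix (α ⊕ β) (α ⊕ β) (MvPolynomial ((α ⊕ β) × (α ⊕ β)) ℤ),
      M.toBlocks₁₁.det ≠ 0 → M.borderedMinors.det = M.toBlocks₁₁.det ^ h * M.det := by
    intro M hM
    have h := det_fromBlocks_mul_det_pow M.toBlocks₁₁ M.toBlocks₁₂ M.toBlocks₂₁ M.toBlocks₂₂ hM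
    rw [fromBlocks_toBlocks, ← borderedMinors_eq, hβ] at h
    refine mul_left_cancel₀ hM ?_
    rw [← h, pow_succ]
    ring
  let f : MvPolynomial ((α ⊕ β) × (α ⊕ β)) ℤ →+* S :=
    (MvPolynomial.aeval fun p : (α ⊕ β) × (α ⊕ β) => M p.1 p.2).toRingHom
  have hf : f.mapMatrix (mvPolynomialX _ _ ℤ) = M := mvPolynomialX_mapMatrix_aeval ℤ M
  have hb : ∀ M : Matrix (α ⊕ β) (α ⊕ β) (MvPolynomial ((α ⊕ β) × (α ⊕ β)) ℤ),
      f.mapMatrix M.borderedMinors = (f.mapMatrix M).borderedMinors := by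
    intro M
    ext b b'
    exact RingHom.map_det f _
  have h := congrArg f (hgen _ det_toBlocks₁₁_mvPolynomialX_ne_zero)
  rw [map_mul, map_pow, RingHom.map_det, RingHom.map_det, RingHom.map_det, hb] at h
  rw [← hf]
  exact h

end Bordered

/-! ### The chain of bordered leading minors -/

section Chain

open Matrix

variable {n : ℕ} {S : Type*} [CommRing S]

/-- The indices below `k`, followed by the `N` indices from `k` on. -/
def blockIdx {k N : ℕ} (h : k + N ≤ n) : {j : Fin n // (j : ℕ) < k} ⊕ Fin N → Fin n :=
  Sum.elim Subtype.val fun a => ⟨k + a, by omega⟩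

theorem blockIdx_injective {k N : ℕ} (h : k + N ≤ n) : Function.Injective (blockIdx h) := by
  rintro (a | a) (b | b) hab
  · exact congrArg Sum.inl (Subtype.ext hab)
  · have h1 : (a : ℕ) = k + b := congrArg Fin.val hab
    have := a.2
    omega
  · have h1 : k + a = (b : ℕ) := congrArg Fin.val hab
    have := b.2
    omega
  · have h1 : k + (a : ℕ) = k + b := congrArg Fin.val hab
    exact congrArg Sum.inr (Fin.ext (by omega))

/-- The indices below `k + N` are those below `k` and the next `N` ones. -/
noncomputable def ltAddEquiv {k N : ℕ} (h : k + N ≤ n) :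
    {j : Fin n // (j : ℕ) < k} ⊕ Fin N ≃ {j : Fin n // (j : ℕ) < k + N} :=
  Equiv.ofBijective
    (fun x => ⟨blockIdx h x, by
      rcases x with ⟨a, ha⟩ | a
      · simp only [blockIdx, Sum.elim_inl]; omega
      · simp [blockIdx]⟩)
    ⟨fun _ _ hab => blockIdx_injective h (congrArg Subtype.val hab), by
      rintro ⟨⟨j, hj⟩, hjk⟩
      simp only at hjk
      by_cases hk : j < k
      · exact ⟨.inl ⟨⟨j, hj⟩, hk⟩, rfl⟩
      · refine ⟨.inr ⟨j - k, by omega⟩, ?_⟩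
        simp only [blockIdx, Sum.elim_inr, Subtype.mk.injEq, Fin.mk.injEq]
        omega⟩

theorem card_fin_lt {k : ℕ} (h : k ≤ n) : Fintype.card {j : Fin n // (j : ℕ) < k} = k := by
  rw [Fintype.card_subtype, Fin.card_filter_val_lt, min_eq_right h]

/-- The minors of `A` that border the leading principal block of order `k` by one of the next `N`
rows and one of the next `N` columns. -/
def leadingMinors (A : Matrix (Fin n) (Fin n) S) {k N : ℕ} (h : k + N ≤ n) :
    Matrix (Fin N) (Fin N) S :=
  (A.submatrix (blockIdx h) (blockIdx h)).borderedMinors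

theorem leadingMinors_apply (A : Matrix (Fin n) (Fin n) S) {k N : ℕ} (h : k + N ≤ n)
    (r s : Fin N) :
    leadingMinors A h r s =
      (A.submatrix (blockIdx h ∘ Sum.map id fun _ : Unit => r)
        (blockIdx h ∘ Sum.map id fun _ : Unit => s)).det :=
  rfl

theorem blockIdx_comp_injective {k N : ℕ} (h : k + N ≤ n) (r : Fin N) :
    Function.Injective (blockIdx h ∘ Sum.map id fun _ : Unit => r) :=
  (blockIdx_injective h).comp
    (Sum.map_injective.mpr ⟨Function.injective_id, fun _ _ _ => rfl⟩)

theorem leadingMinors_congr (A : Matrix (Fin n) (Fin n) S) {k k' N : ℕ} (h : k + N ≤ n)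
    (h' : k' + N ≤ n) (hk : k = k') : leadingMinors A h = leadingMinors A h' := by
  subst hk
  rfl

/-- For the empty block, the bordered minors are the entries. -/
theorem leadingMinors_zero (A : Matrix (Fin n) (Fin n) S) (h : 0 + n ≤ n) :
    leadingMinors A h = A := by
  ext r s
  have : IsEmpty {j : Fin n // (j : ℕ) < 0} := ⟨fun j => absurd j.2 (Nat.not_lt_zero _)⟩
  have : Subsingleton ({j : Fin n // (j : ℕ) < 0} ⊕ Unit) :=
    (Equiv.emptySum _ Unit).injective.subsingleton
  rw [leadingMinors_apply, det_eq_elem_of_subsingleton _ (Sum.inr ()), submatrix_apply]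
  congr <;> simp [blockIdx]

theorem leadingMinors_map {T : Type*} [CommRing T] (f : S →+* T) (A : Matrix (Fin n) (Fin n) S)
    {k N : ℕ} (h : k + N ≤ n) (r s : Fin N) :
    f (leadingMinors A h r s) = leadingMinors (A.map f) h r s :=
  RingHom.map_det f _

theorem leadingDet_map {T : Type*} [CommRing T] (f : S →+* T) (A : Matrix (Fin n) (Fin n) S)
    (k : ℕ) : f (leadingDet A k) = leadingDet (A.map f) k :=
  RingHom.map_det f _

/-- An entry of `Δ(M)` is the minor of `M` bordering the first quadrant. -/
theorem deltaMat_apply {N : ℕ} (M : Matrix (Fin N) (Fin N) S) (r s : Fin (N / 2)) :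
    deltaMat M r s = (M.submatrix (Sum.elim loIdx fun _ : Unit => hiIdx r)
      (Sum.elim loIdx fun _ : Unit => hiIdx s)).det := by
  rw [det_eq_det_mul_sub_adjugate]
  rfl

theorem deltaMat_smul {N : ℕ} (u : S) (M : Matrix (Fin N) (Fin N) S) :
    deltaMat (u • M) = u ^ (N / 2 + 1) • deltaMat M := by
  ext r s
  rw [Matrix.smul_apply, deltaMat_apply, deltaMat_apply, submatrix_smul]
  simp

/-- By Sylvester's identity, `Δ` takes bordered leading minors to bordered leading minors of a
larger block, up to a power of the leading minor. -/
theorem deltaMat_leadingMinors (A : Matrix (Fin n) (Fin n) S) {k N : ℕ} (h : k + N ≤ n) :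
    deltaMat (leadingMinors A h) =
      leadingDet A k ^ (N / 2) • leadingMinors A (k := k + N / 2) (N := N / 2) (by omega) := by
  ext r s
  have h2 : k + N / 2 ≤ n := by omega
  let g : Fin (N / 2) → Fin (N / 2) ⊕ Unit → Fin N := fun r => Sum.elim loIdx fun _ => hiIdx r
  let M := A.submatrix (blockIdx h ∘ Sum.map id (g r)) (blockIdx h ∘ Sum.map id (g s))
  have hM : M.borderedMinors = (leadingMinors A h).submatrix (g r) (g s) := by
    ext b b'
    refine congrArg det ?_
    ext (i | i) (j | j) <;> rfl
  have hsyl := det_borderedMinors M (h := N / 2) (by simp)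
  rw [hM, ← deltaMat_apply] at hsyl
  rw [hsyl, Matrix.smul_apply, smul_eq_mul, leadingMinors_apply]
  congr 1
  let e := (Equiv.sumAssoc _ _ Unit).symm.trans ((ltAddEquiv h2).sumCongr (Equiv.refl Unit))
  rw [← det_submatrix_equiv_self e, submatrix_submatrix]
  refine congrArg det ?_
  have he : ∀ r, blockIdx h ∘ Sum.map id (g r) =
      (blockIdx (k := k + N / 2) (N := N / 2) (by omega) ∘ Sum.map id fun _ : Unit => r) ∘ e := by
    intro r
    ext (x | x | x)
    · rfl
    · rfl
    · simp [blockIdx, g, e, hiIdx, add_assoc]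
  rw [← he, ← he]

theorem chainIdx_add_halve_le (n i : ℕ) : (2 ^ i - 1) * n / 2 ^ i + halve n i ≤ n := by
  rw [halve_eq]
  refine Nat.div_add_div_le_add_div.trans ?_
  rw [Nat.sub_one_mul, Nat.sub_add_cancel (Nat.le_mul_of_pos_left _ (by positivity)),
    Nat.mul_div_cancel_left _ (by positivity)]

/-- The closed form of the cancelled chain of `A`: the `i`-th matrix consists of the minors that
border the leading principal block of order `n - n / 2 ^ i`, which is written as
`(2 ^ i - 1) * n / 2 ^ i`. -/
def minorChain (A : Matrix (Fin n) (Fin n) S) (i : ℕ) :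
    Matrix (Fin (halve n i)) (Fin (halve n i)) S :=
  leadingMinors A (chainIdx_add_halve_le n i)

theorem chainIdx_eq {m i : ℕ} (hi : i ≤ m) :
    (2 ^ i - 1) * 2 ^ m / 2 ^ i = 2 ^ m - 2 ^ (m - i) := by
  obtain ⟨j, rfl⟩ := Nat.exists_eq_add_of_le hi
  rw [Nat.add_sub_cancel_left, pow_add, mul_left_comm, Nat.mul_div_cancel_left _ (by positivity),
    Nat.sub_one_mul]

theorem two_le_halve_iff {m i : ℕ} (hn : n = 2 ^ m) : 2 ≤ halve n (i + 1) ↔ i + 2 ≤ m := by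
  subst hn
  rw [halve_eq]
  rcases le_or_gt (i + 1) m with hi | hi
  · rw [Nat.pow_div hi (by norm_num)]
    constructor
    · intro h
      by_contra hm
      have : m - (i + 1) = 0 := by omega
      simp [this] at h
    · intro h
      exact Nat.le_self_pow (by omega) 2
  · rw [Nat.div_eq_of_lt (Nat.pow_lt_pow_right (by norm_num) hi)]
    omega

theorem deltaMat_minorChain {m : ℕ} (hn : n = 2 ^ m) (A : Matrix (Fin n) (Fin n) S) {i : ℕ}
    (hi : i + 2 ≤ m) :
    deltaMat (minorChain A i) = deltaFactor A i • minorChain A (i + 1) := by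
  have hk : (2 ^ (i + 1) - 1) * n / 2 ^ (i + 1) = (2 ^ i - 1) * n / 2 ^ i + halve n i / 2 := by
    subst hn
    rw [chainIdx_eq (by omega), chainIdx_eq (by omega), halve_eq, Nat.pow_div (by omega) (by omega)]
    have h1 : (2 : ℕ) ^ (m - i) = 2 * 2 ^ (m - (i + 1)) := by
      rw [← pow_succ']
      congr 1
      omega
    have h2 : (2 : ℕ) ^ (m - i) ≤ 2 ^ m := Nat.pow_le_pow_right (by omega) (by omega)
    omega
  have hf : deltaFactor A i = leadingDet A ((2 ^ i - 1) * n / 2 ^ i) ^ (halve n i / 2) :=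
    congrArg (leadingDet A ((2 ^ i - 1) * n / 2 ^ i) ^ ·) (halve_eq n (i + 1)).symm
  rw [hf]
  exact (deltaMat_leadingMinors A _).trans
    (congrArg _ (leadingMinors_congr A (N := halve n i / 2) _ _ hk.symm))

theorem minorChain_zero (A : Matrix (Fin n) (Fin n) S) : minorChain A 0 = A := by
  have h0 : (2 ^ 0 - 1) * n / 2 ^ 0 = 0 := by simp
  exact (leadingMinors_congr A (N := n) _ (by omega) h0).trans (leadingMinors_zero A _)

theorem isDeltaChain_minorChain {m : ℕ} (hn : n = 2 ^ m) (A : Matrix (Fin n) (Fin n) S) :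
    IsDeltaChain A (deltaFactor A) (minorChain A) where
  zero := minorChain_zero A
  step _ hi := deltaMat_minorChain hn A ((two_le_halve_iff hn).mp hi)

/-- As long as the factors do not vanish, the chain is determined by them. -/
theorem IsDeltaChain.eq_minorChain [IsDomain S] {m : ℕ} (hn : n = 2 ^ m)
    {A : Matrix (Fin n) (Fin n) S} {C : (i : ℕ) → Matrix (Fin (halve n i)) (Fin (halve n i)) S}
    (hC : IsDeltaChain A (deltaFactor A) C) {i : ℕ} (hi : i + 1 ≤ m)
    (hf : ∀ j < i, deltaFactor A j ≠ 0) : C i = minorChain A i := by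
  induction i with
  | zero => rw [hC.zero, minorChain_zero]
  | succ i ih =>
    have h1 := hC.step i ((two_le_halve_iff hn).mpr (by omega))
    rw [ih (by omega) fun j hj => hf j (by omega), deltaMat_minorChain hn A (by omega)] at h1
    exact (smul_right_injective _ (hf i (by omega)) h1).symm

end Chain

/-! ### Primality of generic determinants -/

section Prime

open Matrix Polynomial

/-- Pseudo-division by a linear polynomial. -/
theorem Polynomial.exists_C_pow_mul_eq {L : Type*} [CommRing L] (a b : L) (f : Polynomial L) :
    ∃ (N : ℕ) (q : Polynomial L) (r : L), C (a ^ N) * f = (C a * X + C b) * q + C r := by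
  induction f using Polynomial.recOnHorner with
  | M0 => exact ⟨0, 0, 0, by simp⟩
  | MC f c _ _ ih =>
    obtain ⟨N, q, r, h⟩ := ih
    refine ⟨N, q, r + a ^ N * c, ?_⟩
    rw [mul_add, h, C_add, C_mul]
    ring
  | MX f _ ih =>
    obtain ⟨N, q, r, h⟩ := ih
    refine ⟨N + 1, C a * X * q + C r, -(b * r), ?_⟩
    rw [pow_succ, C_mul, C_neg, C_mul]
    linear_combination C a * X * h

/-- A linear polynomial `a X + b` is prime if `a` is prime and does not divide `b`. -/
theorem Polynomial.prime_C_mul_X_add_C {L : Type*} [CommRing L] [IsDomain L] {a b : L}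
    (ha : Prime a) (hab : ¬ a ∣ b) : Prime (C a * X + C b) := by
  have hdeg : (C a * X + C b).degree = 1 := degree_linear ha.ne_zero
  have hp0 : C a * X + C b ≠ 0 := by
    intro h
    simp [h] at hdeg
  have hCa : Prime (C a) := prime_C_iff.mpr ha
  have hnot : ¬ C a ∣ C a * X + C b := by
    rw [dvd_add_right (dvd_mul_right _ _), C_dvd_iff_dvd_coeff]
    intro h
    simpa using hab (by simpa using h 0)
  -- if the pseudo-remainder is zero, the prime power `a ^ N` divides the pseudo-quotient `q`
  have hdvd : ∀ (N : ℕ) (f q : Polynomial L), C (a ^ N) * f = (C a * X + C b) * q →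
      C a * X + C b ∣ f := by
    intro N f q h
    rw [C_pow] at h
    obtain ⟨q', rfl⟩ := hCa.pow_dvd_of_dvd_mul_left N hnot (Dvd.intro _ h)
    refine ⟨q', mul_left_cancel₀ (pow_ne_zero N hCa.ne_zero) ?_⟩
    rw [h]
    ring
  refine ⟨hp0, fun hu => ?_, fun f g hfg => ?_⟩
  · rw [degree_eq_zero_of_isUnit hu] at hdeg
    exact zero_ne_one hdeg
  · obtain ⟨N, q, r, hr⟩ := exists_C_pow_mul_eq a b f
    obtain ⟨N', q', r', hr'⟩ := exists_C_pow_mul_eq a b g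
    have h : C a * X + C b ∣ C (r * r') := by
      have : C (r * r') = C (a ^ N) * C (a ^ N') * (f * g) -
          (C a * X + C b) * (q * (C a * X + C b) * q' + q * C r' + C r * q') := by
        rw [C_mul]
        linear_combination -(C (a ^ N') * g) * hr - ((C a * X + C b) * q + C r) * hr'
      rw [this]
      exact dvd_sub (hfg.mul_left _) (dvd_mul_right _ _)
    have h0 : C (r * r') = 0 := by
      refine eq_zero_of_dvd_of_degree_lt h ?_
      rw [hdeg]
      exact degree_C_lt
    rcases mul_eq_zero.mp (C_eq_zero.mp h0) with h0 | h0
    · left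
      rw [h0, C_0, add_zero] at hr
      exact hdvd N f q hr
    · right
      rw [h0, C_0, add_zero] at hr'
      exact hdvd N' g q' hr'

variable {R : Type*} [CommRing R]

theorem Matrix.det_fromBlocks_C_X {ι L : Type*} [Fintype ι] [DecidableEq ι] [CommRing L]
    (P : Matrix ι ι L) (Q : Matrix ι Unit L) (U : Matrix Unit ι L) :
    (fromBlocks (P.map C) (Q.map C) (U.map C) (of fun _ _ => X)).det =
      C P.det * X + C (-(U * P.adjugate * Q) () ()) := by
  rw [det_eq_det_mul_sub_adjugate, map_neg, map_mul_adjugate_mul_apply, RingHom.map_det,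
    ← sub_eq_add_neg]
  rfl

/-- The determinant of a matrix of distinct indeterminates is linear in the last of them, and its
leading coefficient is the generic determinant of the upper left block. -/
theorem Matrix.prime_det_X_sum_unit [IsDomain R] {ι τ : Type*} [Fintype ι] [DecidableEq ι]
    [Nonempty ι]
    (v : ι ⊕ Unit → ι ⊕ Unit → τ) (hv : Function.Injective (Function.uncurry v))
    (hprime : ∀ w : ι → ι → {t // t ≠ v (.inr ()) (.inr ())},
      Function.Injective (Function.uncurry w) →
        Prime (of fun i j => (MvPolynomial.X (w i j) : MvPolynomial _ R)).det) :
    Prime (of fun i j => (MvPolynomial.X (v i j) : MvPolynomial τ R)).det := by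
  classical
  set x := v (.inr ()) (.inr ()) with hx
  have hne : ∀ i j, (i, j) ≠ (Sum.inr (), Sum.inr ()) → v i j ≠ x := fun i j hij h =>
    hij (hv h)
  let L := MvPolynomial {t // t ≠ x} R
  let P : Matrix ι ι L := of fun i j => MvPolynomial.X ⟨v (.inl i) (.inl j), hne _ _ (by simp)⟩
  let Q : Matrix ι Unit L := of fun i j => MvPolynomial.X ⟨v (.inl i) (.inr j), hne _ _ (by simp)⟩
  let U : Matrix Unit ι L := of fun i j => MvPolynomial.X ⟨v (.inr i) (.inl j), hne _ _ (by simp)⟩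
  let e : MvPolynomial τ R ≃ₐ[R] Polynomial L :=
    (MvPolynomial.renameEquiv R (Equiv.optionSubtypeNe x).symm).trans
      (MvPolynomial.optionEquivLeft R _)
  have he : ∀ t (ht : t ≠ x), e (MvPolynomial.X t) = Polynomial.C (MvPolynomial.X ⟨t, ht⟩) := by
    intro t ht
    change MvPolynomial.optionEquivLeft R _ (MvPolynomial.rename _ (MvPolynomial.X t)) = _
    rw [MvPolynomial.rename_X, Equiv.optionSubtypeNe_symm_of_ne ht,
      MvPolynomial.optionEquivLeft_X_some]
  have hex : e (MvPolynomial.X x) = Polynomial.X := by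
    change MvPolynomial.optionEquivLeft R _ (MvPolynomial.rename _ (MvPolynomial.X x)) = _
    rw [MvPolynomial.rename_X, Equiv.optionSubtypeNe_symm_self,
      MvPolynomial.optionEquivLeft_X_none]
  have hmat : e.mapMatrix (of fun i j => (MvPolynomial.X (v i j) : MvPolynomial τ R)) =
      fromBlocks (P.map Polynomial.C) (Q.map Polynomial.C) (U.map Polynomial.C)
        (of fun _ _ => Polynomial.X) := by
    refine Matrix.ext ?_
    rintro (i | i) (j | j)
    · exact he _ (hne (.inl i) (.inl j) (by simp))
    · exact he _ (hne (.inl i) (.inr j) (by simp))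
    · exact he _ (hne (.inr i) (.inl j) (by simp))
    · exact hex
  have hlin : e (of fun i j => (MvPolynomial.X (v i j) : MvPolynomial τ R)).det =
      Polynomial.C P.det * Polynomial.X + Polynomial.C (-(U * P.adjugate * Q) () ()) := by
    rw [AlgEquiv.map_det, hmat, det_fromBlocks_C_X]
  have hP : Prime P.det := by
    refine hprime _ fun a b hab => ?_
    have h := hv (a₁ := (.inl a.1, .inl a.2)) (a₂ := (.inl b.1, .inl b.2))
      (congrArg Subtype.val hab)
    simpa [Prod.ext_iff] using h
  rw [← MulEquiv.prime_iff e, hlin]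
  refine Polynomial.prime_C_mul_X_add_C hP fun hdvd => ?_
  -- `a = det P` does not divide the constant term: the two are separated by evaluation at the
  -- matrix of a transposition, which has determinant `-1`, a singular
  -- upper left block and corner entry `0`
  obtain ⟨i₀⟩ := ‹Nonempty ι›
  let σ : Equiv.Perm (ι ⊕ Unit) := Equiv.swap (.inl i₀) (.inr ())
  let N : Matrix (ι ⊕ Unit) (ι ⊕ Unit) R := σ.permMatrix R
  let g : L →+* R := MvPolynomial.eval fun t =>
    Function.extend (Function.uncurry v) (Function.uncurry N) 0 t.1
  have hg : ∀ i j (h : v i j ≠ x), g (MvPolynomial.X ⟨v i j, h⟩) = N i j := by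
    intro i j h
    rw [MvPolynomial.eval_X]
    exact hv.extend_apply _ _ (i, j)
  have hN₁ : g.mapMatrix P = N.toBlocks₁₁ := by
    ext i j
    exact hg _ _ _
  have hN₀ : N.toBlocks₁₁.det = 0 := by
    refine det_eq_zero_of_row_eq_zero i₀ fun j => ?_
    simp [N, σ, toBlocks₁₁, PEquiv.toMatrix_apply, Equiv.Perm.permMatrix]
  have hN := det_eq_det_mul_sub_adjugate N
  have hgQ : g (-(U * P.adjugate * Q) () ()) =
      -(N.toBlocks₂₁ * N.toBlocks₁₁.adjugate * N.toBlocks₁₂) () () := by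
    have hU : U.map g = N.toBlocks₂₁ := by
      ext i j
      exact hg _ _ _
    have hQ : Q.map g = N.toBlocks₁₂ := by
      ext i j
      exact hg _ _ _
    rw [map_neg, map_mul_adjugate_mul_apply, hN₁, hU, hQ]
  rw [hN₀, zero_mul, zero_sub, ← hgQ, det_permutation] at hN
  have h0 := map_dvd g hdvd
  rw [RingHom.map_det, hN₁, hN₀, zero_dvd_iff, ← hN] at h0
  simp [σ] at h0

/-- Over an integral domain, the determinant of a nonempty square matrix of distinct indeterminates
is a prime polynomial. -/
theorem Matrix.prime_det_X [IsDomain R] {ι τ : Type*} [Fintype ι] [DecidableEq ι] [Nonempty ι]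
    (v : ι → ι → τ) (hv : Function.Injective (Function.uncurry v)) :
    Prime (of fun i j => (MvPolynomial.X (v i j) : MvPolynomial τ R)).det := by
  have hfin : ∀ (k : ℕ) (τ : Type _) (v : Fin (k + 1) → Fin (k + 1) → τ),
      Function.Injective (Function.uncurry v) →
        Prime (of fun i j => (MvPolynomial.X (v i j) : MvPolynomial τ R)).det := by
    intro k
    induction k with
    | zero =>
      intro τ v _
      have : Subsingleton (Fin (0 + 1)) := inferInstanceAs (Subsingleton (Fin 1))
      rw [det_eq_elem_of_subsingleton _ 0]
      exact MvPolynomial.X_prime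
    | succ k ih =>
      intro τ v hv
      let e : Fin (k + 1) ⊕ Unit ≃ Fin (k + 2) := Fintype.equivOfCardEq (by simp)
      rw [← det_submatrix_equiv_self e]
      refine prime_det_X_sum_unit (fun i j => v (e i) (e j)) (fun a b hab => ?_)
        fun w hw => ih _ w hw
      have h := hv (a₁ := (e a.1, e a.2)) (a₂ := (e b.1, e b.2)) hab
      simpa [Prod.ext_iff] using h
  obtain ⟨k, hk⟩ : ∃ k, Fintype.card ι = k + 1 :=
    Nat.exists_eq_succ_of_ne_zero Fintype.card_ne_zero
  let e : Fin (k + 1) ≃ ι := Fintype.equivOfCardEq (by simp [hk])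
  rw [← det_submatrix_equiv_self e]
  refine hfin k τ (fun i j => v (e i) (e j)) fun a b hab => ?_
  have h := hv (a₁ := (e a.1, e a.2)) (a₂ := (e b.1, e b.2)) hab
  simpa [Prod.ext_iff] using h

end Prime

/-! ### Contents of the symbolic chain -/

section Content

open Matrix

theorem IsMatrixContent.unit_smul {N : ℕ} {S : Type*} [CommRing S] {c u : S}
    {M : Matrix (Fin N) (Fin N) S} (hu : IsUnit u) (h : IsMatrixContent c M) :
    IsMatrixContent c (u • M) := by
  refine ⟨fun r s => (h.1 r s).mul_left u, fun g hg => h.2 g fun r s => ?_⟩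
  exact hu.dvd_mul_left.mp (hg r s)

theorem IsMatrixContent.associated {N : ℕ} {S : Type*} [CommRing S] [IsDomain S] {c c' : S}
    {M : Matrix (Fin N) (Fin N) S} (h : IsMatrixContent c M) (h' : IsMatrixContent c' M) :
    Associated c c' :=
  associated_of_dvd_dvd (h'.2 c h.1) (h.2 c' h'.1)

variable {n : ℕ} {R : Type*} [CommRing R]

theorem mvPolynomialX_map_eval (A : Matrix (Fin n) (Fin n) R) :
    (mvPolynomialX (Fin n) (Fin n) R).map (MvPolynomial.eval fun p => A p.1 p.2) = A :=
  mvPolynomialX_mapMatrix_eval A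

variable [IsDomain R]

theorem leadingDet_mvPolynomialX_ne_zero (k : ℕ) :
    leadingDet (mvPolynomialX (Fin n) (Fin n) R) k ≠ 0 := by
  intro h
  have h1 := congrArg (MvPolynomial.eval fun p => (1 : Matrix (Fin n) (Fin n) R) p.1 p.2) h
  rw [leadingDet_map, mvPolynomialX_map_eval, leadingDet, submatrix_one _ Subtype.val_injective,
    det_one, map_zero] at h1
  exact one_ne_zero h1

theorem deltaFactor_mvPolynomialX_ne_zero (i : ℕ) :
    deltaFactor (mvPolynomialX (Fin n) (Fin n) R) i ≠ 0 :=
  pow_ne_zero _ (leadingDet_mvPolynomialX_ne_zero _)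

theorem prime_leadingMinors_mvPolynomialX {k N : ℕ} (h : k + N ≤ n) (r s : Fin N) :
    Prime (leadingMinors (mvPolynomialX (Fin n) (Fin n) R) h r s) := by
  rw [leadingMinors_apply]
  refine prime_det_X (fun i j => ((blockIdx h ∘ Sum.map id fun _ : Unit => r) i,
    (blockIdx h ∘ Sum.map id fun _ : Unit => s) j)) ?_
  exact (blockIdx_comp_injective h r).prodMap (blockIdx_comp_injective h s)

theorem leadingMinors_diagonal {S : Type*} [CommRing S] (d : Fin n → S) {k N : ℕ} (h : k + N ≤ n)
    (r : Fin N) :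
    leadingMinors (diagonal d) h r r = ∏ i, d ((blockIdx h ∘ Sum.map id fun _ : Unit => r) i) := by
  rw [leadingMinors_apply, submatrix_diagonal _ _ (blockIdx_comp_injective h r), det_diagonal]
  rfl

/-- Two diagonal minors bordering the same block are not multiples of each other: a diagonal matrix
whose only vanishing diagonal entry is the corner of the first minor separates them. -/
theorem not_leadingMinors_dvd {k N : ℕ} (h : k + N ≤ n) {r s : Fin N} (hrs : r ≠ s) :
    ¬ leadingMinors (mvPolynomialX (Fin n) (Fin n) R) h r r ∣
      leadingMinors (mvPolynomialX (Fin n) (Fin n) R) h s s := by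
  intro hdvd
  let d : Fin n → R := fun j => if j = blockIdx h (.inr r) then 0 else 1
  have h1 := map_dvd (MvPolynomial.eval fun p => diagonal d p.1 p.2) hdvd
  rw [leadingMinors_map, leadingMinors_map, mvPolynomialX_map_eval, leadingMinors_diagonal,
    leadingMinors_diagonal, Finset.prod_eq_zero (Finset.mem_univ (Sum.inr ())) (by simp [d]),
    zero_dvd_iff, Finset.prod_eq_one] at h1
  · exact one_ne_zero h1
  · rintro (i | i) -
    · simp [d, (blockIdx_injective h).eq_iff]
    · simp [d, (blockIdx_injective h).eq_iff, hrs.symm]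

/-- The matrix of bordered minors of the symbolic matrix is primitive, since it has two entries
that are primes and not associated. -/
theorem isMatrixContent_smul_leadingMinors {k N : ℕ} (h : k + N ≤ n) (hN : 2 ≤ N)
    (c : MvPolynomial (Fin n × Fin n) R) :
    IsMatrixContent c (c • leadingMinors (mvPolynomialX (Fin n) (Fin n) R) h) := by
  refine ⟨fun r s => Dvd.intro _ rfl, fun g hg => ?_⟩
  rcases eq_or_ne c 0 with rfl | hc
  · exact dvd_zero g
  set M := leadingMinors (mvPolynomialX (Fin n) (Fin n) R) h
  let a : Fin N := ⟨0, by omega⟩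
  let b : Fin N := ⟨1, by omega⟩
  have ha : Prime (M a a) := prime_leadingMinors_mvPolynomialX h a a
  obtain ⟨w, hw⟩ := hg a a
  obtain ⟨v, hv⟩ := hg b b
  rw [Matrix.smul_apply, smul_eq_mul] at hw hv
  have hg0 : g ≠ 0 := by
    rintro rfl
    rw [zero_mul] at hw
    exact mul_ne_zero hc ha.ne_zero hw
  have hcross : w * M b b = M a a * v := by
    refine mul_left_cancel₀ hg0 ?_
    linear_combination M a a * hv - M b b * hw
  obtain ⟨w', rfl⟩ := (ha.dvd_or_dvd (Dvd.intro _ hcross.symm)).resolve_right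
    (not_leadingMinors_dvd h (by simp [a, b]))
  refine ⟨w', mul_left_cancel₀ ha.ne_zero ?_⟩
  linear_combination hw

theorem isMatrixContent_deltaMat_minorChain {m : ℕ} (hn : n = 2 ^ m) {i : ℕ} (hi : i + 2 ≤ m) :
    IsMatrixContent (deltaFactor (mvPolynomialX (Fin n) (Fin n) R) i)
      (deltaMat (minorChain (mvPolynomialX (Fin n) (Fin n) R) i)) := by
  rw [deltaMat_minorChain hn _ hi]
  exact isMatrixContent_smul_leadingMinors _ ((two_le_halve_iff hn).mpr hi) _

theorem isPrimitiveDeltaChain_minorChain {m : ℕ} (hn : n = 2 ^ m) :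
    IsPrimitiveDeltaChain (mvPolynomialX (Fin n) (Fin n) R)
      (deltaFactor (mvPolynomialX (Fin n) (Fin n) R))
      (minorChain (mvPolynomialX (Fin n) (Fin n) R)) :=
  ⟨isDeltaChain_minorChain hn _, fun _ hi =>
    isMatrixContent_deltaMat_minorChain hn ((two_le_halve_iff hn).mp hi)⟩

/-- Contents are unique up to units, hence so is the primitive chain of the symbolic matrix. -/
theorem IsPrimitiveDeltaChain.eq_unit_smul {m : ℕ} (hn : n = 2 ^ m)
    {c : ℕ → MvPolynomial (Fin n × Fin n) R}
    {C : (i : ℕ) → Matrix (Fin (halve n i)) (Fin (halve n i)) (MvPolynomial (Fin n × Fin n) R)}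
    (hC : IsPrimitiveDeltaChain (mvPolynomialX (Fin n) (Fin n) R) c C) {i : ℕ} (hi : i + 1 ≤ m) :
    ∃ u : MvPolynomial (Fin n × Fin n) R, IsUnit u ∧
      C i = u • minorChain (mvPolynomialX (Fin n) (Fin n) R) i := by
  induction i with
  | zero => exact ⟨1, isUnit_one,
      (hC.1.zero.trans (minorChain_zero _).symm).trans (one_smul _ _).symm⟩
  | succ i ih =>
    obtain ⟨u, hu, hCi⟩ := ih (by omega)
    have h2 : 2 ≤ halve n (i + 1) := (two_le_halve_iff hn).mpr (by omega)
    have hcont := hC.2 i h2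
    have hstep := hC.1.step i h2
    rw [hCi, deltaMat_smul] at hcont hstep
    obtain ⟨w, hw⟩ := hcont.associated
      ((isMatrixContent_deltaMat_minorChain hn (by omega)).unit_smul (hu.pow _))
    have hc : c i ≠ 0 := by
      intro h0
      rw [h0, zero_mul] at hw
      exact deltaFactor_mvPolynomialX_ne_zero i hw.symm
    refine ⟨u ^ (halve n i / 2 + 1) * w, (hu.pow _).mul w.isUnit, smul_right_injective _ hc ?_⟩
    refine hstep.symm.trans ?_
    rw [deltaMat_minorChain hn _ (by omega), ← hw]
    refine Matrix.ext fun r s => ?_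
    change u ^ (halve n i / 2 + 1) * (c i * w * minorChain _ (i + 1) r s) =
      c i * (u ^ (halve n i / 2 + 1) * w * minorChain _ (i + 1) r s)
    ring

theorem IsPrimitiveDeltaChain.isMatrixContent {m : ℕ} (hn : n = 2 ^ m)
    {c : ℕ → MvPolynomial (Fin n × Fin n) R}
    {C : (i : ℕ) → Matrix (Fin (halve n i)) (Fin (halve n i)) (MvPolynomial (Fin n × Fin n) R)}
    (hC : IsPrimitiveDeltaChain (mvPolynomialX (Fin n) (Fin n) R) c C) {i : ℕ} (hi : i + 2 ≤ m) :
    IsMatrixContent (deltaFactor (mvPolynomialX (Fin n) (Fin n) R) i) (deltaMat (C i)) := by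
  obtain ⟨u, hu, hCi⟩ := IsPrimitiveDeltaChain.eq_unit_smul hn hC (i := i) (by omega)
  rw [hCi, deltaMat_smul]
  exact (isMatrixContent_deltaMat_minorChain hn hi).unit_smul (hu.pow _)

end Content

/-! ### Degrees of determinants and top coefficients -/

section Degree

open Matrix MvPolynomial

variable {ι σ R : Type*} [Fintype ι] [DecidableEq ι] [CommRing R]

theorem MvPolynomial.totalDegree_det_le {d : ℕ} (M : Matrix ι ι (MvPolynomial σ R))
    (hM : ∀ i j, (M i j).totalDegree ≤ d) : M.det.totalDegree ≤ Fintype.card ι * d := by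
  rw [← mem_restrictTotalDegree, det_apply]
  refine Submodule.sum_mem _ fun τ _ => ?_
  rw [Units.smul_def]
  refine zsmul_mem ?_ _
  rw [mem_restrictTotalDegree]
  refine (totalDegree_finsetProd _ _).trans ((Finset.sum_le_sum fun i _ => hM _ _).trans ?_)
  simp

theorem MvPolynomial.coeff_single_mul {p q : MvPolynomial σ R} {a b : ℕ} (x : σ)
    (hp : p.totalDegree ≤ a) (hq : q.totalDegree ≤ b) :
    (p * q).coeff (.single x (a + b)) = p.coeff (.single x a) * q.coeff (.single x b) := by
  classical
  have hzero : ∀ {p : MvPolynomial σ R} {a : ℕ} {u : σ →₀ ℕ}, p.totalDegree ≤ a →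
      a < u.degree → p.coeff u = 0 :=
    fun hp hu => coeff_eq_zero_of_totalDegree_lt (hp.trans_lt hu)
  rw [coeff_mul, Finsupp.antidiagonal_single, Finset.sum_map]
  refine Finset.sum_eq_single (a, b) (fun t ht hne => ?_) fun h => absurd (by simp) h
  rw [Finset.HasAntidiagonal.mem_antidiagonal] at ht
  rcases lt_or_ge a t.1 with h | h
  · exact mul_eq_zero_of_left (hzero hp (by simpa using h)) _
  -- here `t.1 < a`, and since `t.1 + t.2 = a + b`, the second exponent exceeds `b`
  · have : t.1 ≠ a := fun h => hne (Prod.ext h (by omega))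
    exact mul_eq_zero_of_right _ (hzero hq (by simp; omega))

theorem MvPolynomial.coeff_single_prod {κ : Type*} (s : Finset κ) (f : κ → MvPolynomial σ R)
    {d : ℕ} (x : σ) (hf : ∀ i, (f i).totalDegree ≤ d) :
    (∏ i ∈ s, f i).coeff (.single x (s.card * d)) = ∏ i ∈ s, (f i).coeff (.single x d) := by
  classical
  induction s using Finset.induction_on with
  | empty => simp
  | insert i s hi ih =>
    rw [Finset.prod_insert hi, Finset.prod_insert hi, Finset.card_insert_of_notMem hi, add_mul,
      one_mul, add_comm, coeff_single_mul x (hf i), ih]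
    refine (totalDegree_finsetProd _ _).trans ((Finset.sum_le_sum fun i _ => hf i).trans ?_)
    simp

/-- The coefficient of a determinant at the highest possible power of a variable is the determinant
of the corresponding coefficients of the entries. -/
theorem MvPolynomial.coeff_single_det {d : ℕ} (x : σ) (M : Matrix ι ι (MvPolynomial σ R))
    (hM : ∀ i j, (M i j).totalDegree ≤ d) :
    M.det.coeff (.single x (Fintype.card ι * d)) = (M.map (coeff (.single x d))).det := by
  rw [det_apply, det_apply, coeff_sum]
  refine Finset.sum_congr rfl fun τ _ => ?_
  rw [Units.smul_def, Units.smul_def, ← lcoeff_apply, map_zsmul, lcoeff_apply]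
  congr 1
  exact coeff_single_prod Finset.univ (fun i => M (τ i) i) x fun i => hM _ _

theorem MvPolynomial.isWeightedHomogeneous_det_X (d : ℕ) (v : ι → ι → σ) :
    IsWeightedHomogeneous (fun _ => d) (of fun i j => (X (v i j) : MvPolynomial σ R)).det
      (Fintype.card ι * d) := by
  rw [← mem_weightedHomogeneousSubmodule, det_apply]
  refine Submodule.sum_mem _ fun τ _ => ?_
  rw [Units.smul_def]
  refine zsmul_mem ?_ _
  rw [mem_weightedHomogeneousSubmodule]
  have h := IsWeightedHomogeneous.prod (R := R) (w := fun _ : σ => d) Finset.univ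
    (fun i => X (v (τ i) i)) (fun _ => d) fun i _ => isWeightedHomogeneous_X R _ _
  simpa using h

end Degree

/-! ### Degrees along the chain -/

section ChainDegree

open Matrix MvPolynomial

variable {n : ℕ} {σ R : Type*} [CommRing R]

theorem chainIdx_succ_le (n i : ℕ) {m : ℕ} (hn : n = 2 ^ m) (hi : i + 1 ≤ m) :
    (2 ^ (i + 1) - 1) * n / 2 ^ (i + 1) + 1 ≤ n := by
  subst hn
  rw [chainIdx_eq hi]
  have h1 : 1 ≤ 2 ^ (m - (i + 1)) := Nat.one_le_two_pow
  have h2 : 2 ^ (m - (i + 1)) ≤ 2 ^ m := Nat.pow_le_pow_right (by omega) (by omega)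
  omega

theorem card_fin_lt_sum_unit {k : ℕ} (h : k ≤ n) :
    Fintype.card ({j : Fin n // (j : ℕ) < k} ⊕ Unit) = k + 1 := by
  rw [Fintype.card_sum, card_fin_lt h, Fintype.card_unit]

theorem totalDegree_leadingMinors_le {d k N : ℕ} {B : Matrix (Fin n) (Fin n) (MvPolynomial σ R)}
    (hB : ∀ r s, (B r s).totalDegree ≤ d) (h : k + N ≤ n) (r s : Fin N) :
    (leadingMinors B h r s).totalDegree ≤ (k + 1) * d := by
  rw [leadingMinors_apply, ← card_fin_lt_sum_unit (n := n) (k := k) (by omega)]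
  exact totalDegree_det_le _ fun i j => hB _ _

theorem coeff_single_leadingMinors {d k N : ℕ} {B : Matrix (Fin n) (Fin n) (MvPolynomial σ R)}
    (x : σ) (hB : ∀ r s, (B r s).totalDegree ≤ d) (h : k + N ≤ n) (r s : Fin N) :
    (leadingMinors B h r s).coeff (.single x ((k + 1) * d)) =
      leadingMinors (B.map (coeff (.single x d))) h r s := by
  rw [leadingMinors_apply, ← card_fin_lt_sum_unit (n := n) (k := k) (by omega)]
  exact coeff_single_det x _ fun i j => hB _ _

theorem coeff_single_leadingDet {d k : ℕ} {B : Matrix (Fin n) (Fin n) (MvPolynomial σ R)}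
    (x : σ) (hB : ∀ r s, (B r s).totalDegree ≤ d) (h : k ≤ n) :
    (leadingDet B k).coeff (.single x (k * d)) =
      leadingDet (B.map (coeff (.single x d))) k := by
  have hdet := coeff_single_det x (B.submatrix (Subtype.val : {j : Fin n // (j : ℕ) < k} → Fin n)
    Subtype.val) fun i j => hB _ _
  rwa [card_fin_lt h] at hdet

theorem weightedTotalDegree_unit_mul_leadingMinors [IsDomain R] {k N : ℕ} (h : k + N ≤ n)
    (r s : Fin N) {u : MvPolynomial (Fin n × Fin n) R} (hu : IsUnit u) (d : ℕ) :
    weightedTotalDegree (fun _ => d)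
      (u * leadingMinors (mvPolynomialX (Fin n) (Fin n) R) h r s) = (k + 1) * d := by
  obtain ⟨a, -, rfl⟩ := isUnit_iff_eq_C_of_isReduced.mp hu
  have hhom : IsWeightedHomogeneous (fun _ => d)
      (leadingMinors (mvPolynomialX (Fin n) (Fin n) R) h r s) ((k + 1) * d) := by
    rw [leadingMinors_apply, ← card_fin_lt_sum_unit (n := n) (k := k) (by omega)]
    exact isWeightedHomogeneous_det_X d fun i j =>
      ((blockIdx h ∘ Sum.map id fun _ : Unit => r) i, (blockIdx h ∘ Sum.map id fun _ : Unit => s) j)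
  have hmul := (isWeightedHomogeneous_C (fun _ : Fin n × Fin n => d) a).mul hhom
  rw [zero_add] at hmul
  have h0 := mul_ne_zero hu.ne_zero
    (prime_leadingMinors_mvPolynomialX (R := R) h r s).ne_zero
  have hdeg := hmul.weighted_total_degree h0
  rw [weightedTotalDegree_coe _ _ h0] at hdeg
  exact WithBot.coe_injective hdeg

/-- The product of the leading minors and of the bordered minors that occur in the chain of the
symbolic matrix. Where it does not vanish, no factor and no entry of the chain vanishes. -/
noncomputable def chainDiscriminant (n m : ℕ) (R : Type*) [CommRing R] :
    MvPolynomial (Fin n × Fin n) R :=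
  ∏ i ∈ Finset.range m, leadingDet (mvPolynomialX (Fin n) (Fin n) R) ((2 ^ i - 1) * n / 2 ^ i) *
    ∏ r, ∏ s, minorChain (mvPolynomialX (Fin n) (Fin n) R) i r s

theorem chainDiscriminant_ne_zero [IsDomain R] (n m : ℕ) : chainDiscriminant n m R ≠ 0 :=
  Finset.prod_ne_zero_iff.mpr fun _ _ => mul_ne_zero (leadingDet_mvPolynomialX_ne_zero _)
    (Finset.prod_ne_zero_iff.mpr fun r _ => Finset.prod_ne_zero_iff.mpr fun s _ =>
      (prime_leadingMinors_mvPolynomialX _ r s).ne_zero)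

theorem ne_zero_of_aeval_chainDiscriminant_ne_zero {S : Type*} [CommRing S] [IsDomain S]
    [Algebra R S] {m : ℕ} {A : Matrix (Fin n) (Fin n) S}
    (hA : aeval (fun p : Fin n × Fin n => A p.1 p.2) (chainDiscriminant n m R) ≠ 0) {i : ℕ}
    (hi : i < m) :
    leadingDet A ((2 ^ i - 1) * n / 2 ^ i) ≠ 0 ∧ ∀ r s, minorChain A i r s ≠ 0 := by
  let f : MvPolynomial (Fin n × Fin n) R →+* S :=
    (aeval fun p : Fin n × Fin n => A p.1 p.2).toRingHom
  have hf : (mvPolynomialX (Fin n) (Fin n) R).map f = A := mvPolynomialX_mapMatrix_aeval R A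
  change f _ ≠ 0 at hA
  rw [chainDiscriminant, map_prod, Finset.prod_ne_zero_iff] at hA
  have h := hA i (Finset.mem_range.mpr hi)
  rw [map_mul, map_prod, leadingDet_map, hf] at h
  refine ⟨left_ne_zero_of_mul h, fun r s => ?_⟩
  have h1 := Finset.prod_ne_zero_iff.mp (right_ne_zero_of_mul h) r (Finset.mem_univ r)
  rw [map_prod] at h1
  have h2 := Finset.prod_ne_zero_iff.mp h1 s (Finset.mem_univ s)
  rwa [minorChain, leadingMinors_map, hf] at h2

end ChainDegree

/-! ### Contents and degrees of the cancelled chain -/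

theorem mainTheorem2 {R : Type*} [CommRing R] [IsDomain R] (n m : ℕ) (hn : n = 2 ^ m) :
    -- the symbolic matrix: the chain exists, has the stated contents and the stated degrees,
    -- where every symbol counts as an entry of degree `d`
    ((∃ c C, IsPrimitiveDeltaChain (Matrix.mvPolynomialX (Fin n) (Fin n) R) c C) ∧
      ∀ c C, IsPrimitiveDeltaChain (Matrix.mvPolynomialX (Fin n) (Fin n) R) c C →
        ∀ i, i + 2 ≤ m →
          IsMatrixContent (deltaFactor (Matrix.mvPolynomialX (Fin n) (Fin n) R) i)
            (deltaMat (C i)) ∧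
          ∀ r s, C (i + 1) r s ≠ 0 ∧
            ∀ d : ℕ, MvPolynomial.weightedTotalDegree (fun _ => d) (C (i + 1) r s) =
              ((2 ^ (i + 1) - 1) * n / 2 ^ (i + 1) + 1) * d) ∧
    -- every matrix of polynomials of degree at most `d`: the divisions are exact, and the
    -- degrees are at most the stated ones
    (∀ (σ : Type*) (d : ℕ) (B : Matrix (Fin n) (Fin n) (MvPolynomial σ R)),
      (∀ r s, (B r s).totalDegree ≤ d) →
        (∃ C, IsDeltaChain B (deltaFactor B) C) ∧
        ∀ C, IsDeltaChain B (deltaFactor B) C → ∀ i, i + 2 ≤ m →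
          (∀ j ≤ i, deltaFactor B j ≠ 0) →
            ∀ r s, (C (i + 1) r s).totalDegree ≤
              ((2 ^ (i + 1) - 1) * n / 2 ^ (i + 1) + 1) * d) ∧
    -- the degrees are exactly the stated ones outside the zero set of a nonzero polynomial `Φ`
    -- in the coefficients of the entries
    (∀ (σ : Type*) [Nonempty σ] (d : ℕ),
      ∃ Φ : MvPolynomial (Fin n × Fin n × {α : σ →₀ ℕ // α.degree ≤ d}) R, Φ ≠ 0 ∧
        ∀ (S : Type*) [CommRing S] [IsDomain S] [Algebra R S]
          (B : Matrix (Fin n) (Fin n) (MvPolynomial σ S)),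
          (∀ r s, (B r s).totalDegree ≤ d) →
          MvPolynomial.aeval (fun t => (B t.1 t.2.1).coeff t.2.2.1) Φ ≠ 0 →
            (∀ i, i + 2 ≤ m → deltaFactor B i ≠ 0) ∧
            ∀ C, IsDeltaChain B (deltaFactor B) C → ∀ i, i + 2 ≤ m →
              ∀ r s, C (i + 1) r s ≠ 0 ∧ (C (i + 1) r s).totalDegree =
                ((2 ^ (i + 1) - 1) * n / 2 ^ (i + 1) + 1) * d) ∧
    -- the stated degree is `O(n d)`, with constant one
    ∀ i, i + 2 ≤ m → ∀ d : ℕ, ((2 ^ (i + 1) - 1) * n / 2 ^ (i + 1) + 1) * d ≤ n * d := by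
  refine ⟨⟨⟨_, _, isPrimitiveDeltaChain_minorChain hn⟩, fun c C hC i hi =>
    ⟨IsPrimitiveDeltaChain.isMatrixContent hn hC hi, fun r s => ?_⟩⟩, fun σ d B hB =>
    ⟨⟨_, isDeltaChain_minorChain hn B⟩, fun C hC i hi hf r s => ?_⟩, fun σ _ d => ?_,
    fun i hi d => Nat.mul_le_mul_right d (chainIdx_succ_le n i hn (by omega))⟩
  · obtain ⟨u, hu, hCi⟩ := IsPrimitiveDeltaChain.eq_unit_smul hn hC (i := i + 1) (by omega)
    rw [hCi, Matrix.smul_apply, smul_eq_mul]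
    exact ⟨mul_ne_zero hu.ne_zero (prime_leadingMinors_mvPolynomialX _ r s).ne_zero,
      weightedTotalDegree_unit_mul_leadingMinors _ r s hu⟩
  · rw [hC.eq_minorChain hn (i := i + 1) (by omega) fun j hj => hf j (by omega)]
    exact totalDegree_leadingMinors_le hB _ r s
  · obtain ⟨x⟩ := ‹Nonempty σ›
    -- `Φ` only looks at the coefficients of the pure power `x ^ d`
    let top : Fin n × Fin n → Fin n × Fin n × {α : σ →₀ ℕ // α.degree ≤ d} := fun p =>
      (p.1, p.2, ⟨.single x d, (Finsupp.degree_single x d).le⟩)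
    have htop : Function.Injective top := fun p q hpq => by
      simp only [top, Prod.mk.injEq] at hpq
      exact Prod.ext hpq.1 hpq.2.1
    refine ⟨MvPolynomial.rename top (chainDiscriminant n m R),
      (map_ne_zero_iff _ (MvPolynomial.rename_injective top htop)).mpr
        (chainDiscriminant_ne_zero n m), fun S _ _ _ B hB hΦ => ?_⟩
    rw [MvPolynomial.aeval_rename] at hΦ
    have hne : ∀ i < m, _ := fun i hi => ne_zero_of_aeval_chainDiscriminant_ne_zero
      (A := B.map (MvPolynomial.coeff (.single x d))) hΦ hi
    have hfac : ∀ i, i + 2 ≤ m → deltaFactor B i ≠ 0 := by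
      intro i hi
      refine pow_ne_zero _ fun h0 => (hne i (by omega)).1 ?_
      rw [← coeff_single_leadingDet x hB
        ((Nat.le_add_right _ _).trans (chainIdx_add_halve_le n i)), h0, MvPolynomial.coeff_zero]
    refine ⟨hfac, fun C hC i hi r s => ?_⟩
    rw [hC.eq_minorChain hn (i := i + 1) (by omega) fun j hj => hfac j (by omega)]
    have hcoeff := (hne (i + 1) (by omega)).2 r s
    rw [minorChain, ← coeff_single_leadingMinors x hB] at hcoeff
    refine ⟨fun h0 => hcoeff (by rw [← minorChain, h0, MvPolynomial.coeff_zero]),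
      (totalDegree_leadingMinors_le hB _ r s).antisymm ?_⟩
    have hle := MvPolynomial.le_totalDegree (MvPolynomial.mem_support_iff.mpr hcoeff)
    rwa [Finsupp.sum_single_index rfl] at hle
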